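/- Let $H$ be a complex Hilbert space of finite dimension $d\ge 1$ with orthonormal basis $e_1,\dots,e_d$, and let $U$ be a unitary operator on $H$. Let $X_i=|e_i\rangle\langle e_i|$ and $Y_i=UX_iU^\dagger$ be the elements of the two corresponding projective measurements, and write $U$ also for the matrix $U_{ij}=\langle e_i|Ue_j\rangle$ of $U$ in the basis $(e_i)$. For a state $\rho$ (a positive operator on $H$ with trace one) let $H(X|\rho)=-\sum_i \operatorname{tr}(\rho X_i)\log\operatorname{tr}(\rho X_i)$ and $H(Y|\rho)=-\sum_i \operatorname{tr}(\rho Y_i)\log\operatorname{tr}(\rho Y_i)$ be the Shannon entropies of the outcome distributions, with $0\log 0=0$. For real $\lambda,\mu\ge 0$ let $$c(\lambda,\mu)=\inf_\rho\ \bigl(\lambda H(X|\rho)+\mu H(Y|\rho)\bigr),$$ the infimum being over all states. For $0<p<\infty$ and $x\in\mathbb{C}^d$ put $\|x\|_p=(\sum_i|x_i|^p)^{1/p}$, put $\|x\|_\infty=\max_i|x_i|$, and let $B_p=\{x\in\mathbb{C}^d:\|x\|_p\le 1\}$. For real $N\ge 1$ put $$\omega_N(\lambda,\mu)=\sup_{x\in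 B_r,\ y\in B_s}\bigl|x^\dagger U y\bigr|,\qquad r=\frac{2N}{N+2\lambda},\quad s=\frac{2N}{N+2\mu}.$$ Then the following hold. (i) For every real $N\ge 1$, $\;c(\lambda,\mu)\ge -N\log\omega_N(\lambda,\mu)$. (ii) For every real $N\ge1$ with $\lambda\le N/2$ and $\mu\le N/2$, $$\omega_N(\lambda,\mu)=\sup_{0\ne\phi\in\mathbb{C}^d}\frac{\|U\phi\|_{r'}}{\|\phi\|_s}=\sup_{0\ne\phi\in\mathbb{C}^d}\frac{\|U^\dagger\phi\|_{s'}}{\|\phi\|_r},\qquad r'=\frac{2N}{N-2\lambda},\quad s'=\frac{2N}{N-2\mu},$$ where $r'=\infty$ if $\lambda=N/2$ and $s'=\infty$ if $\mu=N/2$. (iii) If $\lambda,\mu>0$, then $\;c(\lambda,\mu)=\lim_{N\to\infty}-N\log\omega_N(\lambda,\mu)$, the limit being over real $N$. -/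

import Mathlib

namespace EntropicUncertainty

noncomputable section

variable {d : ℕ} {H : Type*} [NormedAddCommGroup H] [InnerProductSpace ℂ H]

/-- A quantum state: a positive operator of trace one. -/
def IsState (ρ : H →ₗ[ℂ] H) : Prop :=
  ρ.IsPositive ∧ LinearMap.trace ℂ H ρ = 1

/-- The elements `X i = |e i⟩⟨e i|` of the non-degenerate projective measurement in the
orthonormal basis `e`. -/
def measX (e : OrthonormalBasis (Fin d) ℂ H) (i : Fin d) : H →ₗ[ℂ] H :=
  (InnerProductSpace.rankOne ℂ (e i) (e i)).toLinearMap

/-- The elements `Y i = U (X i) U†` of the second measurement (`U† = U⁻¹` as `U` is unitary). -/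
def measY (e : OrthonormalBasis (Fin d) ℂ H) (U : H ≃ₗᵢ[ℂ] H) (i : Fin d) : H →ₗ[ℂ] H :=
  U.toLinearEquiv.toLinearMap ∘ₗ measX e i ∘ₗ U.symm.toLinearEquiv.toLinearMap

/-- The probability `tr (ρ P i)` of the `i`-th outcome of the measurement `P` in the state `ρ`. -/
def outcomeProb (P : Fin d → H →ₗ[ℂ] H) (ρ : H →ₗ[ℂ] H) (i : Fin d) : ℝ :=
  (LinearMap.trace ℂ H (ρ ∘ₗ P i)).re

/-- The Shannon entropy `H(P|ρ)` of the outcome distribution (with `0 log 0 = 0`). -/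
def shannonEntropy (P : Fin d → H →ₗ[ℂ] H) (ρ : H →ₗ[ℂ] H) : ℝ :=
  -∑ i, outcomeProb P ρ i * Real.log (outcomeProb P ρ i)

/-- The optimal constant `c(λ, μ) = inf_ρ (λ H(X|ρ) + μ H(Y|ρ))`. -/
def optConst (e : OrthonormalBasis (Fin d) ℂ H) (U : H ≃ₗᵢ[ℂ] H) (lam mu : ℝ) : ℝ :=
  sInf {t : ℝ | ∃ ρ : H →ₗ[ℂ] H, IsState ρ ∧
    t = lam * shannonEntropy (measX e) ρ + mu * shannonEntropy (measY e U) ρ}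

/-- The matrix of `U` in the basis `e`, with entries `⟨e i, U (e j)⟩`. -/
def basisMatrix (e : OrthonormalBasis (Fin d) ℂ H) (U : H ≃ₗᵢ[ℂ] H) : Matrix (Fin d) (Fin d) ℂ :=
  LinearMap.toMatrix e.toBasis e.toBasis U.toLinearEquiv.toLinearMap

/-- The `p`-norm `(∑ |x i| ^ p) ^ (1 / p)` on `ℂ ^ d` for `0 < p < ∞` (a quasi-norm if `p < 1`),
and `max |x i|` for `p = ∞`. -/
def pNorm (p : ENNReal) (x : Fin d → ℂ) : ℝ :=
  ‖(WithLp.toLp p x : PiLp p fun _ : Fin d => ℂ)‖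

/-- The closed unit ball of the `p`-norm. -/
def pBall (d : ℕ) (p : ENNReal) : Set (Fin d → ℂ) := {x | pNorm p x ≤ 1}

/-- The exponent `2N / (N + 2λ)`. -/
def ballExp (N lam : ℝ) : ENNReal := ENNReal.ofReal (2 * N / (N + 2 * lam))

/-- The exponent `2N / (N - 2λ)` for `λ ≤ N / 2`, which is `∞` for `λ = N / 2`. -/
def dualExp (N lam : ℝ) : ENNReal := ENNReal.ofReal (2 * N) / ENNReal.ofReal (N - 2 * lam)

/-- The numbers `|x† M y|` for `x` in the unit `r`-ball and `y` in the unit `s`-ball. -/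
def omegaSet (M : Matrix (Fin d) (Fin d) ℂ) (r s : ENNReal) : Set ℝ :=
  {t : ℝ | ∃ x ∈ pBall d r, ∃ y ∈ pBall d s, t = ‖star x ⬝ᵥ M.mulVec y‖}

/-- `ω_N(λ, μ)`, the supremum of `|x† M y|` over the two unit balls. -/
def omega (M : Matrix (Fin d) (Fin d) ℂ) (N lam mu : ℝ) : ℝ :=
  sSup (omegaSet M (ballExp N lam) (ballExp N mu))

/-- The operator norm of `M` from the `p`-norm to the `q`-norm. -/
def opNorm (M : Matrix (Fin d) (Fin d) ℂ) (p q : ENNReal) : ℝ :=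
  sSup {t : ℝ | ∃ φ : Fin d → ℂ, φ ≠ 0 ∧ t = pNorm q (M.mulVec φ) / pNorm p φ}

end

/-- Entries of a vector in a unit ball have modulus at most one. -/
lemma norm_le_one_of_mem_pBall {d : ℕ} {p : ENNReal} (hp : 0 < p.toReal) {x : Fin d → ℂ}
    (hx : x ∈ pBall d p) (i : Fin d) : ‖x i‖ ≤ 1 := by
  have h1 : (∑ j, ‖x j‖ ^ p.toReal) ^ (1 / p.toReal) ≤ 1 := by
    have h := PiLp.norm_eq_sum hp (WithLp.toLp p x : PiLp p fun _ : Fin d => ℂ)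
    have h' : pNorm p x ≤ 1 := hx
    rw [pNorm, h] at h'
    exact h'
  have hnn : 0 ≤ ∑ j, ‖x j‖ ^ p.toReal :=
    Finset.sum_nonneg fun j _ => Real.rpow_nonneg (norm_nonneg _) _
  have h2 : ∑ j, ‖x j‖ ^ p.toReal ≤ 1 := by
    by_contra! hc
    exact absurd h1 (not_le.mpr (Real.one_lt_rpow hc (by positivity)))
  have h3 : ‖x i‖ ^ p.toReal ≤ ∑ j, ‖x j‖ ^ p.toReal :=
    Finset.single_le_sum (f := fun j => ‖x j‖ ^ p.toReal)
      (fun j _ => Real.rpow_nonneg (norm_nonneg _) _) (Finset.mem_univ i)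
  by_contra! hc
  exact absurd (h3.trans h2) (not_le.mpr (Real.one_lt_rpow hc hp))

/-- The supremum that defines `omega` is that of a bounded set. -/
lemma bddAbove_omegaSet {d : ℕ} (M : Matrix (Fin d) (Fin d) ℂ) {N lam mu : ℝ} (hN : 0 < N)
    (hlam : 0 ≤ lam) (hmu : 0 ≤ mu) : BddAbove (omegaSet M (ballExp N lam) (ballExp N mu)) := by
  have hexp : ∀ a : ℝ, 0 ≤ a → 0 < (ballExp N a).toReal := fun a ha => by
    have : 0 < 2 * N / (N + 2 * a) := by positivity
    rw [ballExp, ENNReal.toReal_ofReal this.le]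
    exact this
  refine ⟨∑ i, ∑ j, ‖M i j‖, ?_⟩
  rintro t ⟨x, hx, y, hy, rfl⟩
  simp only [dotProduct, Matrix.mulVec]
  refine (norm_sum_le _ _).trans (Finset.sum_le_sum fun i _ => ?_)
  have hxi := norm_le_one_of_mem_pBall (hexp lam hlam) hx i
  rw [norm_mul, Pi.star_apply, norm_star]
  refine (mul_le_of_le_one_left (norm_nonneg _) hxi).trans ?_
  refine (norm_sum_le _ _).trans (Finset.sum_le_sum fun j _ => ?_)
  have hyj := norm_le_one_of_mem_pBall (hexp mu hmu) hy j
  rw [norm_mul]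
  exact mul_le_of_le_one_right (norm_nonneg _) hyj

end EntropicUncertainty

open EntropicUncertainty

/-!
By concavity of the Shannon entropy the infimum `c(λ, μ)` is governed by pure states, that is, by
unit vectors `b` together with `a = U b`, where `U` is the matrix of the unitary.

(i) The form `x(z)† U y(z)`, with `x(z)`, `y(z)` obtained from `a`, `b` by multiplying their entries
by `|a i| ^ (2λz/N)` and `|b j| ^ (2μz/N)`, is entire in `z`, equals `1` at `z = 0`, and is bounded
by `1` on `Re z = 0` and by `ω_N` on `Re z = 1`. By the three lines theorem its modulus at
`σ ∈ [0, 1]` is at most `ω_N ^ σ`; comparing the derivatives at `σ = 0` gives the bound.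

(ii) is the duality between `p`-norms with Hölder conjugate exponents.

(iii) The tangent line at `p = 2` of the convex function `p ↦ ∑ |x i| ^ p` shows that
`‖x‖₂ ≤ exp (-λ/(N + 2λ) H(x))` on the unit `r`-ball, so by Cauchy–Schwarz `N log |x† U y|` is
asymptotically at most `-(λ H(x) + μ H(y))`. For `K < c(λ, μ)` this gives `|x† U y| ≤ exp (-K / N)`
for large `N` near every pair with `|x† U y| = 1`, since equality in Cauchy–Schwarz makes `y` a unit
vector and `x` a phase times `U y`; near the other pairs in the Euclidean balls `|x† U y|` stays
away from `1` while `exp (-K / N) → 1`. Compactness makes this uniform, so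
`ω_N ≤ exp (-K / N)` for large `N`.
-/

namespace EntropicUncertainty

open Filter Topology
open scoped ComplexConjugate Matrix

section VecEntropy

variable {ι m n : Type*} [Fintype ι] [Fintype m] [Fintype n]

/-- The Shannon entropy of the weights `‖a i‖ ^ 2`: the entropy of a measurement outcome in a pure
state with coordinates `a`. It is defined for every vector, normalized or not. -/
noncomputable def vecEntropy (a : ι → ℂ) : ℝ := ∑ i, Real.negMulLog (‖a i‖ ^ 2)

lemma norm_le_one_of_sum_sq_le_one {a : ι → ℂ} (ha : ∑ i, ‖a i‖ ^ 2 ≤ 1) (i : ι) : ‖a i‖ ≤ 1 :=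
  (sq_le_one_iff₀ (norm_nonneg _)).mp <|
    (Finset.single_le_sum (f := fun j => ‖a j‖ ^ 2) (fun _ _ => sq_nonneg _)
      (Finset.mem_univ i)).trans ha

lemma vecEntropy_nonneg {a : ι → ℂ} (ha : ∀ i, ‖a i‖ ≤ 1) : 0 ≤ vecEntropy a :=
  Finset.sum_nonneg fun i _ => Real.negMulLog_nonneg (sq_nonneg _) <|
    (sq_le_one_iff₀ (norm_nonneg _)).mpr (ha i)

lemma continuous_vecEntropy : Continuous (vecEntropy : (ι → ℂ) → ℝ) := by
  unfold vecEntropy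
  fun_prop

lemma vecEntropy_smul {z : ℂ} (hz : ‖z‖ = 1) (a : ι → ℂ) : vecEntropy (z • a) = vecEntropy a := by
  simp [vecEntropy, hz]

lemma vecEntropy_star (a : ι → ℂ) : vecEntropy (star a) = vecEntropy a := by
  simp [vecEntropy]

lemma star_dotProduct_self (a : ι → ℂ) : star a ⬝ᵥ a = ((∑ i, ‖a i‖ ^ 2 : ℝ) : ℂ) := by
  simp [dotProduct, Complex.conj_mul']

lemma star_mulVec_dotProduct_mulVec [DecidableEq n] {M : Matrix m n ℂ} (hM : Mᴴ * M = 1)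
    (x y : n → ℂ) : star (M *ᵥ x) ⬝ᵥ M *ᵥ y = star x ⬝ᵥ y := by
  rw [Matrix.star_mulVec, ← Matrix.dotProduct_mulVec, Matrix.mulVec_mulVec, hM, Matrix.one_mulVec]

lemma sum_sq_norm_mulVec [DecidableEq n] {M : Matrix m n ℂ} (hM : Mᴴ * M = 1) (b : n → ℂ) :
    ∑ i, ‖(M *ᵥ b) i‖ ^ 2 = ∑ j, ‖b j‖ ^ 2 := by
  have h := star_mulVec_dotProduct_mulVec hM b b
  rw [star_dotProduct_self, star_dotProduct_self] at h
  exact_mod_cast h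

lemma norm_dotProduct_sq_le (x y : ι → ℂ) :
    ‖x ⬝ᵥ y‖ ^ 2 ≤ (∑ i, ‖x i‖ ^ 2) * ∑ i, ‖y i‖ ^ 2 := by
  have h : ‖x ⬝ᵥ y‖ ≤ ∑ i, ‖x i‖ * ‖y i‖ := by
    simpa only [dotProduct, norm_mul] using norm_sum_le Finset.univ fun i => x i * y i
  calc ‖x ⬝ᵥ y‖ ^ 2 ≤ (∑ i, ‖x i‖ * ‖y i‖) ^ 2 := by gcongr
    _ ≤ _ := Finset.sum_mul_sq_le_sq_mul_sq _ _ _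

lemma norm_dotProduct_mulVec_sq_le [DecidableEq n] {M : Matrix m n ℂ} (hM : Mᴴ * M = 1)
    (x : m → ℂ) (y : n → ℂ) :
    ‖x ⬝ᵥ M *ᵥ y‖ ^ 2 ≤ (∑ i, ‖x i‖ ^ 2) * ∑ j, ‖y j‖ ^ 2 :=
  sum_sq_norm_mulVec hM y ▸ norm_dotProduct_sq_le x (M *ᵥ y)

end VecEntropy

section States

variable {d : ℕ} {H : Type*} [NormedAddCommGroup H] [InnerProductSpace ℂ H]
  (e f : OrthonormalBasis (Fin d) ℂ H) (U : H ≃ₗᵢ[ℂ] H)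

lemma measY_eq_measX_map : measY e U = measX (e.map U) := by
  ext i v
  have h : inner ℂ (e i) (U.symm v) = inner ℂ (U (e i)) v := by
    rw [← U.inner_map_map, U.apply_symm_apply]
  simp [measY, measX, h]

lemma outcomeProb_measX (ρ : H →ₗ[ℂ] H) (i : Fin d) :
    outcomeProb (measX f) ρ i = (inner ℂ (f i) (ρ (f i))).re := by
  have := f.toBasis.finiteDimensional_of_finite
  have h : ρ ∘ₗ measX f i = (InnerProductSpace.rankOne ℂ (ρ (f i)) (f i)).toLinearMap := by
    ext v
    simp [measX]
  rw [outcomeProb, h, InnerProductSpace.trace_rankOne]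

lemma shannonEntropy_eq_sum_negMulLog (P : Fin d → H →ₗ[ℂ] H) (ρ : H →ₗ[ℂ] H) :
    shannonEntropy P ρ = ∑ i, Real.negMulLog (outcomeProb P ρ i) := by
  simp [shannonEntropy, Real.negMulLog]

lemma conjTranspose_mul_basisMatrix : (basisMatrix e U)ᴴ * basisMatrix e U = 1 :=
  Matrix.mem_unitaryGroup_iff'.mp (U.toMatrix_mem_unitaryGroup e e)

lemma basisMatrix_mulVec_inner (ψ : H) :
    basisMatrix e U *ᵥ (fun j => inner ℂ (e.map U j) ψ) = fun i => inner ℂ (e i) ψ := by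
  have h : (fun j => inner ℂ (e.map U j) ψ) = ⇑(e.toBasis.repr (U.symm ψ)) := by
    ext j
    rw [e.coe_toBasis_repr_apply, e.repr_apply_apply, ← U.inner_map_map (e j), U.apply_symm_apply,
      e.map_apply]
  rw [h, basisMatrix, LinearMap.toMatrix_mulVec_repr]
  ext i
  simp [e.repr_apply_apply]

lemma outcomeProb_measX_eq_sum_eigenbasis {n : Type*} [Fintype n] {ρ : H →ₗ[ℂ] H}
    (v : OrthonormalBasis n ℂ H) {w : n → ℝ} (hv : ∀ k, ρ (v k) = (w k : ℂ) • v k) (i : Fin d) :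
    outcomeProb (measX f) ρ i = ∑ k, w k * ‖inner ℂ (f i) (v k)‖ ^ 2 := by
  have h : ρ (f i) = ∑ k, (inner ℂ (v k) (f i) * w k : ℂ) • v k := by
    conv_lhs => rw [← v.sum_repr' (f i)]
    simp only [map_sum, map_smul, hv, smul_smul]
  rw [outcomeProb_measX, h, inner_sum, Complex.re_sum]
  refine Finset.sum_congr rfl fun k _ => ?_
  rw [inner_smul_right, mul_right_comm, ← inner_conj_symm, Complex.conj_mul',
    ← Complex.ofReal_pow, ← Complex.ofReal_mul, Complex.ofReal_re, mul_comm]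

lemma sum_mul_vecEntropy_le_shannonEntropy {n : Type*} [Fintype n] {ρ : H →ₗ[ℂ] H}
    (v : OrthonormalBasis n ℂ H) {w : n → ℝ} (hv : ∀ k, ρ (v k) = (w k : ℂ) • v k)
    (hw : ∀ k, 0 ≤ w k) (hw1 : ∑ k, w k = 1) :
    ∑ k, w k * vecEntropy (fun i => inner ℂ (f i) (v k)) ≤ shannonEntropy (measX f) ρ := by
  simp only [shannonEntropy_eq_sum_negMulLog, vecEntropy, Finset.mul_sum]
  rw [Finset.sum_comm]
  refine Finset.sum_le_sum fun i _ => ?_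
  rw [outcomeProb_measX_eq_sum_eigenbasis f v hv]
  exact Real.concaveOn_negMulLog.le_map_sum (fun k _ => hw k) hw1
    fun k _ => Set.mem_Ici.mpr (sq_nonneg _)

lemma isState_rankOne [FiniteDimensional ℂ H] {ψ : H} (hψ : ‖ψ‖ = 1) :
    IsState (InnerProductSpace.rankOne ℂ ψ ψ).toLinearMap := by
  refine ⟨(InnerProductSpace.isPositive_rankOne_self ψ).toLinearMap, ?_⟩
  rw [InnerProductSpace.trace_rankOne, inner_self_eq_norm_sq_to_K, hψ]
  simp

lemma shannonEntropy_rankOne (ψ : H) :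
    shannonEntropy (measX f) (InnerProductSpace.rankOne ℂ ψ ψ).toLinearMap =
      vecEntropy fun i => inner ℂ (f i) ψ := by
  rw [shannonEntropy_eq_sum_negMulLog, vecEntropy]
  refine Finset.sum_congr rfl fun i _ => ?_
  rw [outcomeProb_measX, ContinuousLinearMap.coe_coe, InnerProductSpace.rankOne_apply,
    inner_smul_right, ← inner_conj_symm, Complex.conj_mul', ← Complex.ofReal_pow,
    Complex.ofReal_re]

lemma exists_isState_of_sum_sq_eq_one (lam mu : ℝ) {b : Fin d → ℂ} (hb : ∑ j, ‖b j‖ ^ 2 = 1) :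
    ∃ ρ : H →ₗ[ℂ] H, IsState ρ ∧
      lam * vecEntropy (basisMatrix e U *ᵥ b) + mu * vecEntropy b =
        lam * shannonEntropy (measX e) ρ + mu * shannonEntropy (measY e U) ρ := by
  have := e.toBasis.finiteDimensional_of_finite
  obtain ⟨ψ, hψ⟩ := (e.map U).repr.surjective (WithLp.toLp 2 b)
  have hψ1 : ‖ψ‖ = 1 := by
    rw [← LinearIsometryEquiv.norm_map (e.map U).repr, hψ, EuclideanSpace.norm_eq]
    simp [hb]
  obtain rfl : (fun j => inner ℂ (e.map U j) ψ) = b := by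
    ext j
    rw [← OrthonormalBasis.repr_apply_apply, hψ]
  refine ⟨_, isState_rankOne hψ1, ?_⟩
  rw [measY_eq_measX_map, shannonEntropy_rankOne, shannonEntropy_rankOne,
    basisMatrix_mulVec_inner]

lemma le_shannonEntropy_add_of_forall_vec {lam mu K : ℝ} (hlam : 0 ≤ lam) (hmu : 0 ≤ mu)
    (hK : ∀ b : Fin d → ℂ, ∑ j, ‖b j‖ ^ 2 = 1 →
      K ≤ lam * vecEntropy (basisMatrix e U *ᵥ b) + mu * vecEntropy b)
    {ρ : H →ₗ[ℂ] H} (hρ : IsState ρ) :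
    K ≤ lam * shannonEntropy (measX e) ρ + mu * shannonEntropy (measY e U) ρ := by
  have := e.toBasis.finiteDimensional_of_finite
  have hs := hρ.1.isSymmetric
  let v := hs.eigenvectorBasis rfl
  let w := hs.eigenvalues rfl
  have hv : ∀ k, ρ (v k) = (w k : ℂ) • v k := hs.apply_eigenvectorBasis rfl
  have hw : ∀ k, 0 ≤ w k := hρ.1.nonneg_eigenvalues rfl
  have hw1 : ∑ k, w k = 1 := by
    rw [← hs.re_trace_eq_sum_eigenvalues, hρ.2, RCLike.one_re]
  have hpure : ∀ k, K ≤ lam * vecEntropy (fun i => inner ℂ (e i) (v k)) +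
      mu * vecEntropy (fun i => inner ℂ (e.map U i) (v k)) := fun k => by
    rw [← basisMatrix_mulVec_inner e U]
    refine hK _ ?_
    rw [(e.map U).sum_sq_norm_inner_right, v.orthonormal.norm_eq_one, one_pow]
  rw [measY_eq_measX_map]
  calc K = ∑ k, w k * K := by rw [← Finset.sum_mul, hw1, one_mul]
    _ ≤ ∑ k, w k * (lam * vecEntropy (fun i => inner ℂ (e i) (v k)) +
        mu * vecEntropy (fun i => inner ℂ (e.map U i) (v k))) :=
      Finset.sum_le_sum fun k _ => mul_le_mul_of_nonneg_left (hpure k) (hw k)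
    _ = lam * ∑ k, w k * vecEntropy (fun i => inner ℂ (e i) (v k)) +
        mu * ∑ k, w k * vecEntropy (fun i => inner ℂ (e.map U i) (v k)) := by
      simp only [mul_add, Finset.sum_add_distrib, Finset.mul_sum, mul_left_comm]
    _ ≤ _ := by
      gcongr <;> exact sum_mul_vecEntropy_le_shannonEntropy _ v hv hw hw1

theorem le_optConst_iff [NeZero d] {lam mu K : ℝ} (hlam : 0 ≤ lam) (hmu : 0 ≤ mu) :
    K ≤ optConst e U lam mu ↔ ∀ b : Fin d → ℂ, ∑ j, ‖b j‖ ^ 2 = 1 →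
      K ≤ lam * vecEntropy (basisMatrix e U *ᵥ b) + mu * vecEntropy b := by
  have hbdd : BddBelow {t : ℝ | ∃ ρ : H →ₗ[ℂ] H, IsState ρ ∧
      t = lam * shannonEntropy (measX e) ρ + mu * shannonEntropy (measY e U) ρ} := by
    refine ⟨0, ?_⟩
    rintro _ ⟨ρ, hρ, rfl⟩
    refine le_shannonEntropy_add_of_forall_vec e U hlam hmu (fun b hb => ?_) hρ
    have ha := (sum_sq_norm_mulVec (conjTranspose_mul_basisMatrix e U) b).trans hb
    have hHa := vecEntropy_nonneg (norm_le_one_of_sum_sq_le_one ha.le)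
    have hHb := vecEntropy_nonneg (norm_le_one_of_sum_sq_le_one hb.le)
    positivity
  have hne : ∑ j, ‖(Pi.single 0 1 : Fin d → ℂ) j‖ ^ 2 = 1 := by
    simp [Pi.single_apply, apply_ite (fun z : ℂ => ‖z‖ ^ 2)]
  rw [optConst, le_csInf_iff hbdd ⟨_, exists_isState_of_sum_sq_eq_one e U lam mu hne⟩]
  constructor
  · exact fun h b hb => h _ (exists_isState_of_sum_sq_eq_one e U lam mu hb)
  · rintro h _ ⟨ρ, hρ, rfl⟩
    exact le_shannonEntropy_add_of_forall_vec e U hlam hmu h hρ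

end States

section PNorm

variable {d : ℕ} {p q : ENNReal}

lemma pNorm_eq_rpow_sum (hp : 0 < p.toReal) (x : Fin d → ℂ) :
    pNorm p x = (∑ i, ‖x i‖ ^ p.toReal) ^ (1 / p.toReal) :=
  PiLp.norm_eq_sum hp _

lemma pNorm_one (x : Fin d → ℂ) : pNorm 1 x = ∑ i, ‖x i‖ :=
  PiLp.norm_eq_of_L1 _

lemma pNorm_top (x : Fin d → ℂ) : pNorm ⊤ x = ⨆ i, ‖x i‖ :=
  PiLp.norm_eq_ciSup _

lemma norm_apply_le_pNorm_top (x : Fin d → ℂ) (i : Fin d) : ‖x i‖ ≤ pNorm ⊤ x :=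
  pNorm_top x ▸ le_ciSup (f := fun i => ‖x i‖) (Set.finite_range _).bddAbove i

lemma pNorm_nonneg (hp : 1 ≤ p) (x : Fin d → ℂ) : 0 ≤ pNorm p x :=
  have : Fact (1 ≤ p) := ⟨hp⟩
  norm_nonneg (WithLp.toLp p x : PiLp p fun _ : Fin d => ℂ)

lemma pNorm_pos (hp : 1 ≤ p) {x : Fin d → ℂ} (hx : x ≠ 0) : 0 < pNorm p x :=
  have : Fact (1 ≤ p) := ⟨hp⟩
  norm_pos_iff.mpr fun h => hx (by simpa using h)

lemma pNorm_smul (hp : 1 ≤ p) (c : ℂ) (x : Fin d → ℂ) : pNorm p (c • x) = ‖c‖ * pNorm p x :=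
  have : Fact (1 ≤ p) := ⟨hp⟩
  norm_smul c (WithLp.toLp p x : PiLp p fun _ : Fin d => ℂ)

lemma mem_pBall_iff_sum_le_one (hp : 0 < p.toReal) {x : Fin d → ℂ} :
    x ∈ pBall d p ↔ ∑ i, ‖x i‖ ^ p.toReal ≤ 1 := by
  have h0 : 0 ≤ ∑ i, ‖x i‖ ^ p.toReal := Finset.sum_nonneg fun _ _ => by positivity
  have h := Real.rpow_le_rpow_iff h0 zero_le_one (one_div_pos.mpr hp)
  rwa [Real.one_rpow, ← pNorm_eq_rpow_sum hp] at h

lemma mem_pBall_ballExp_iff {N lam : ℝ} (hN : 0 < N) (hlam : 0 ≤ lam) {x : Fin d → ℂ} :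
    x ∈ pBall d (ballExp N lam) ↔ ∑ i, ‖x i‖ ^ (2 * N / (N + 2 * lam)) ≤ 1 := by
  have hp : 0 < 2 * N / (N + 2 * lam) := by positivity
  have h : (ballExp N lam).toReal = 2 * N / (N + 2 * lam) := ENNReal.toReal_ofReal hp.le
  rw [mem_pBall_iff_sum_le_one (h ▸ hp), h]

lemma norm_star_dotProduct_le_sum {ι : Type*} [Fintype ι] (x y : ι → ℂ) :
    ‖star x ⬝ᵥ y‖ ≤ ∑ i, ‖x i‖ * ‖y i‖ := by
  simpa only [dotProduct, norm_mul, Pi.star_apply, norm_star] using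
    norm_sum_le Finset.univ fun i => star x i * y i

lemma norm_star_dotProduct_le_pNorm_one_mul_pNorm_top (x y : Fin d → ℂ) :
    ‖star x ⬝ᵥ y‖ ≤ pNorm 1 x * pNorm ⊤ y := by
  rw [pNorm_one, Finset.sum_mul]
  refine (norm_star_dotProduct_le_sum x y).trans (Finset.sum_le_sum fun i _ => ?_)
  exact mul_le_mul_of_nonneg_left (norm_apply_le_pNorm_top y i) (norm_nonneg _)

lemma norm_star_dotProduct_le_pNorm_mul_pNorm [p.HolderConjugate q] (x y : Fin d → ℂ) :
    ‖star x ⬝ᵥ y‖ ≤ pNorm p x * pNorm q y := by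
  by_cases hq : q = ⊤
  · obtain rfl := (ENNReal.HolderConjugate.eq_top_iff_eq_one q p).mp hq
    exact hq ▸ norm_star_dotProduct_le_pNorm_one_mul_pNorm_top x y
  by_cases hp : p = ⊤
  · obtain rfl := (ENNReal.HolderConjugate.eq_top_iff_eq_one p q).mp hp
    rw [hp, Matrix.star_dotProduct, norm_star, mul_comm]
    exact norm_star_dotProduct_le_pNorm_one_mul_pNorm_top y x
  have hpq := ENNReal.HolderConjugate.toReal_of_ne_top hp hq
  rw [pNorm_eq_rpow_sum hpq.pos, pNorm_eq_rpow_sum hpq.symm.pos]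
  exact (norm_star_dotProduct_le_sum x y).trans <|
    Real.inner_le_Lp_mul_Lq_of_nonneg _ hpq (fun _ _ => norm_nonneg _) fun _ _ => norm_nonneg _

lemma exists_norm_eq_and_norm_star_dotProduct_eq {ι : Type*} [Fintype ι] {g : ι → ℝ}
    (hg : 0 ≤ g) (z : ι → ℂ) :
    ∃ x : ι → ℂ, (∀ i, ‖x i‖ = g i) ∧ ‖star x ⬝ᵥ z‖ = ∑ i, g i * ‖z i‖ := by
  choose u hu huz using fun i => RCLike.exists_norm_eq_mul_self (z i)
  refine ⟨fun i => g i * star (u i), fun i => by simp [hu, abs_of_nonneg (hg i)], ?_⟩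
  have h : (star fun i => (g i : ℂ) * star (u i)) ⬝ᵥ z = ((∑ i, g i * ‖z i‖ : ℝ) : ℂ) := by
    rw [dotProduct, Complex.ofReal_sum]
    refine Finset.sum_congr rfl fun i _ => ?_
    rw [Pi.star_apply, star_mul', star_star, mul_assoc, ← huz i]
    simp
  rw [h, Complex.norm_real,
    Real.norm_of_nonneg (Finset.sum_nonneg fun i _ => mul_nonneg (hg i) (norm_nonneg _))]

lemma exists_mem_pBall_norm_star_dotProduct_eq [NeZero d] [p.HolderConjugate q]
    (z : Fin d → ℂ) : ∃ x ∈ pBall d p, ‖star x ⬝ᵥ z‖ = pNorm q z := by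
  suffices h : ∃ g : Fin d → ℝ, 0 ≤ g ∧
      (∀ x : Fin d → ℂ, (∀ i, ‖x i‖ = g i) → x ∈ pBall d p) ∧ ∑ i, g i * ‖z i‖ = pNorm q z by
    obtain ⟨g, hg, hball, hsum⟩ := h
    obtain ⟨x, hx, hxz⟩ := exists_norm_eq_and_norm_star_dotProduct_eq hg z
    exact ⟨x, hball x hx, hxz.trans hsum⟩
  by_cases hq : q = ⊤
  · obtain rfl := (ENNReal.HolderConjugate.eq_top_iff_eq_one q p).mp hq
    obtain ⟨i, hi⟩ := exists_eq_ciSup_of_finite (f := fun i => ‖z i‖)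
    refine ⟨Pi.single i 1, Pi.single_nonneg.mpr zero_le_one, fun x hx => ?_, ?_⟩
    · change pNorm 1 x ≤ 1
      simp [pNorm_one, hx]
    · rw [hq, pNorm_top, ← hi]
      simp [Pi.single_apply]
  by_cases hp : p = ⊤
  · obtain rfl := (ENNReal.HolderConjugate.eq_top_iff_eq_one p q).mp hp
    refine ⟨fun _ => 1, fun _ => zero_le_one, fun x hx => ?_, by simp [pNorm_one]⟩
    change pNorm p x ≤ 1
    simp [hp, pNorm_top, hx]
  have hpq := ENNReal.HolderConjugate.toReal_of_ne_top hp hq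
  obtain ⟨g, hg, hgz⟩ := (NNReal.isGreatest_Lp Finset.univ (fun i => ‖z i‖₊) hpq.symm).1
  refine ⟨fun i => g i, fun i => (g i).2, fun x hx => ?_, ?_⟩
  · rw [mem_pBall_iff_sum_le_one hpq.pos]
    simp only [hx]
    exact_mod_cast hg
  · rw [pNorm_eq_rpow_sum hpq.symm.pos]
    simpa [mul_comm] using congrArg NNReal.toReal hgz

theorem sSup_omegaSet_eq_opNorm [NeZero d] [p.HolderConjugate q] (M : Matrix (Fin d) (Fin d) ℂ)
    {s : ENNReal} (hs : 1 ≤ s) : sSup (omegaSet M p s) = opNorm M s q := by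
  have hq : 1 ≤ q := ENNReal.HolderConjugate.one_le q p
  refine csSup_eq_csSup_of_forall_exists_le ?_ ?_
  · rintro _ ⟨x, hx, y, hy, rfl⟩
    rcases eq_or_ne y 0 with rfl | hy0
    · obtain ⟨φ, hφ⟩ := exists_ne (0 : Fin d → ℂ)
      refine ⟨_, ⟨φ, hφ, rfl⟩, ?_⟩
      rw [Matrix.mulVec_zero, dotProduct_zero, norm_zero]
      exact div_nonneg (pNorm_nonneg hq _) (pNorm_nonneg hs _)
    · refine ⟨_, ⟨y, hy0, rfl⟩, ?_⟩
      calc ‖star x ⬝ᵥ M *ᵥ y‖ ≤ pNorm p x * pNorm q (M *ᵥ y) :=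
            norm_star_dotProduct_le_pNorm_mul_pNorm _ _
        _ ≤ pNorm q (M *ᵥ y) := mul_le_of_le_one_left (pNorm_nonneg hq _) hx
        _ ≤ pNorm q (M *ᵥ y) / pNorm s y := le_div_self (pNorm_nonneg hq _) (pNorm_pos hs hy0) hy
  · rintro _ ⟨φ, hφ, rfl⟩
    have hpos := pNorm_pos hs hφ
    let c : ℂ := ((pNorm s φ)⁻¹ : ℝ)
    have hc : ‖c‖ = (pNorm s φ)⁻¹ := by
      rw [Complex.norm_real, Real.norm_of_nonneg (inv_nonneg.mpr hpos.le)]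
    obtain ⟨x, hx, hxφ⟩ :=
      exists_mem_pBall_norm_star_dotProduct_eq (p := p) (q := q) (M *ᵥ (c • φ))
    refine ⟨_, ⟨x, hx, c • φ, ?_, rfl⟩, ?_⟩
    · exact (pNorm_smul hs c φ).trans_le (by rw [hc, inv_mul_cancel₀ hpos.ne'])
    · rw [hxφ, Matrix.mulVec_smul, pNorm_smul hq, hc, div_eq_inv_mul]

lemma omegaSet_conjTranspose (M : Matrix (Fin d) (Fin d) ℂ) (r s : ENNReal) :
    omegaSet Mᴴ s r = omegaSet M r s := by
  have h (x y : Fin d → ℂ) : ‖star y ⬝ᵥ Mᴴ *ᵥ x‖ = ‖star x ⬝ᵥ M *ᵥ y‖ := by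
    rw [Matrix.star_dotProduct, norm_star, Matrix.star_mulVec, Matrix.conjTranspose_conjTranspose,
      ← Matrix.dotProduct_mulVec]
  ext t
  constructor
  · rintro ⟨y, hy, x, hx, rfl⟩
    exact ⟨x, hx, y, hy, h x y⟩
  · rintro ⟨x, hx, y, hy, rfl⟩
    exact ⟨y, hy, x, hx, (h x y).symm⟩

lemma omega_conjTranspose (M : Matrix (Fin d) (Fin d) ℂ) (N lam mu : ℝ) :
    omega Mᴴ N mu lam = omega M N lam mu := by
  rw [omega, omegaSet_conjTranspose, omega]

lemma ballExp_inv {N lam : ℝ} (hN : 0 < N) (hlam : 0 ≤ lam) :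
    (ballExp N lam)⁻¹ = ENNReal.ofReal ((N + 2 * lam) / (2 * N)) := by
  rw [ballExp, ← ENNReal.ofReal_inv_of_pos (by positivity), inv_div]

lemma dualExp_inv {N : ℝ} (lam : ℝ) (hN : 0 < N) :
    (dualExp N lam)⁻¹ = ENNReal.ofReal ((N - 2 * lam) / (2 * N)) := by
  have h : ENNReal.ofReal (2 * N) ≠ 0 := by simpa using hN
  rw [dualExp, ENNReal.inv_div (.inl ENNReal.ofReal_ne_top) (.inr h),
    ENNReal.ofReal_div_of_pos (by positivity)]

lemma holderConjugate_ballExp_dualExp {N lam : ℝ} (hN : 0 < N) (hlam : 0 ≤ lam)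
    (h : lam ≤ N / 2) : (ballExp N lam).HolderConjugate (dualExp N lam) := by
  refine ⟨?_⟩
  rw [ballExp_inv hN hlam, dualExp_inv lam hN, inv_one,
    ← ENNReal.ofReal_add (by positivity) (div_nonneg (by linarith) (by positivity)),
    ENNReal.ofReal_eq_one]
  field_simp
  ring

end PNorm

section MaassenUffink

variable {ι m n : Type*}

/-- The vector with entries `a i * |a i| ^ z`, along which the three lines theorem interpolates
between a vector of the Euclidean ball and one of a `p`-ball. The power is written as an
exponential, so that with `log 0 = 0` it is entire in `z` at the zero entries as well. -/
noncomputable def radialTwist (z : ℂ) (a : ι → ℂ) : ι → ℂ :=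
  fun i => a i * Complex.exp (z * Real.log ‖a i‖)

lemma radialTwist_zero (a : ι → ℂ) : radialTwist 0 a = a := by
  ext i
  simp [radialTwist]

lemma star_radialTwist (z : ℂ) (a : ι → ℂ) :
    star (radialTwist z a) = radialTwist (conj z) (star a) := by
  ext i
  simp [radialTwist, ← Complex.exp_conj]

lemma hasDerivAt_radialTwist (c : ℂ) (a : ι → ℂ) (z : ℂ) :
    HasDerivAt (fun z => radialTwist (c * z) a)
      (fun i => radialTwist (c * z) a i * (c * Real.log ‖a i‖)) z := by
  refine hasDerivAt_pi.mpr fun i => ?_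
  have h := (((hasDerivAt_id z).const_mul c).mul_const (Real.log ‖a i‖ : ℂ)).cexp.const_mul (a i)
  simp only [id_eq, mul_one, ← mul_assoc] at h
  simpa only [radialTwist, ← mul_assoc] using h

lemma norm_radialTwist_apply {z : ℂ} (hz : 0 ≤ z.re) (a : ι → ℂ) (i : ι) :
    ‖radialTwist z a i‖ = ‖a i‖ ^ (1 + z.re) := by
  rw [radialTwist, norm_mul, Complex.norm_exp, Complex.re_mul_ofReal]
  rcases (norm_nonneg (a i)).eq_or_lt with h | h
  · rw [← h, zero_mul, Real.zero_rpow (by positivity)]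
  · rw [Real.rpow_add h, Real.rpow_one, Real.rpow_def_of_pos h, mul_comm z.re]

lemma sum_sq_norm_radialTwist_le_one [Fintype ι] {z : ℂ} (hz : 0 ≤ z.re) {a : ι → ℂ}
    (ha : ∑ i, ‖a i‖ ^ 2 ≤ 1) : ∑ i, ‖radialTwist z a i‖ ^ 2 ≤ 1 := by
  refine (Finset.sum_le_sum fun i _ => ?_).trans ha
  rw [norm_radialTwist_apply hz]
  gcongr
  exact Real.rpow_le_self_of_le_one (norm_nonneg _) (norm_le_one_of_sum_sq_le_one ha i)
    (le_add_of_nonneg_right hz)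

lemma radialTwist_mem_pBall {d : ℕ} {N lam : ℝ} (hN : 0 < N) (hlam : 0 ≤ lam) {z : ℂ}
    (hz : z.re = 2 * lam / N) {a : Fin d → ℂ} (ha : ∑ i, ‖a i‖ ^ 2 ≤ 1) :
    radialTwist z a ∈ pBall d (ballExp N lam) := by
  rw [mem_pBall_ballExp_iff hN hlam]
  refine (Finset.sum_congr rfl fun i _ => ?_).trans_le ha
  have hexp : (1 + 2 * lam / N) * (2 * N / (N + 2 * lam)) = 2 := by
    have : N + 2 * lam ≠ 0 := by positivity
    field_simp
  rw [norm_radialTwist_apply (hz ▸ by positivity), hz, ← Real.rpow_mul (norm_nonneg _), hexp,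
    Real.rpow_two]

lemma star_dotProduct_mul_log_norm [Fintype ι] (c : ℝ) (a : ι → ℂ) :
    star a ⬝ᵥ (fun i => a i * (c * Real.log ‖a i‖)) = (-(c / 2 * vecEntropy a) : ℝ) := by
  rw [vecEntropy, Finset.mul_sum, ← Finset.sum_neg_distrib, Complex.ofReal_sum]
  refine Finset.sum_congr rfl fun i _ => ?_
  have h : ‖a i‖ ^ 2 * (c * Real.log ‖a i‖) = -(c / 2 * Real.negMulLog (‖a i‖ ^ 2)) := by
    rw [Real.negMulLog, Real.log_pow]
    push_cast
    ring
  rw [← h, Pi.star_apply, ← mul_assoc, Complex.star_def, Complex.conj_mul']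
  push_cast
  rfl

lemma hasDerivAt_dotProduct_mulVec [Fintype m] [Fintype n] {M : Matrix m n ℂ}
    {x : ℂ → m → ℂ} {y : ℂ → n → ℂ} {x' : m → ℂ} {y' : n → ℂ} {z : ℂ}
    (hx : HasDerivAt x x' z) (hy : HasDerivAt y y' z) :
    HasDerivAt (fun z => x z ⬝ᵥ M *ᵥ y z) (x' ⬝ᵥ M *ᵥ y z + x z ⬝ᵥ M *ᵥ y') z := by
  have hMy (i : m) : HasDerivAt (fun z => (M *ᵥ y z) i) ((M *ᵥ y') i) z :=
    HasDerivAt.fun_sum fun j _ => (hasDerivAt_pi.mp hy j).const_mul (M i j)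
  have h := HasDerivAt.fun_sum (u := Finset.univ) fun i _ => (hasDerivAt_pi.mp hx i).mul (hMy i)
  rwa [Finset.sum_add_distrib] at h

/-- The form `x† M y` along the twists of `a` and `b`. Conjugating the parameter of the twist of
`a` compensates for the `†` and makes the form entire in `z`. -/
noncomputable def twistedForm [Fintype m] [Fintype n] (M : Matrix m n ℂ) (s t : ℝ) (a : m → ℂ)
    (b : n → ℂ) (z : ℂ) : ℂ :=
  star (radialTwist (s * conj z) a) ⬝ᵥ M *ᵥ radialTwist (t * z) b

section

variable [Fintype m] [Fintype n] (s t : ℝ)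

lemma twistedForm_eq (M : Matrix m n ℂ) (a : m → ℂ) (b : n → ℂ) :
    twistedForm M s t a b =
      fun z => radialTwist (s * z) (star a) ⬝ᵥ M *ᵥ radialTwist (t * z) b := by
  ext z
  simp [twistedForm, star_radialTwist]

lemma differentiable_twistedForm (M : Matrix m n ℂ) (a : m → ℂ) (b : n → ℂ) :
    Differentiable ℂ (twistedForm M s t a b) := fun z => by
  rw [twistedForm_eq]
  exact (hasDerivAt_dotProduct_mulVec (hasDerivAt_radialTwist s (star a) z)
    (hasDerivAt_radialTwist t b z)).differentiableAt

variable [DecidableEq n] {M : Matrix m n ℂ} (hM : Mᴴ * M = 1) {b : n → ℂ}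
include hM

lemma twistedForm_mulVec_zero (hb : ∑ j, ‖b j‖ ^ 2 = 1) : twistedForm M s t (M *ᵥ b) b 0 = 1 := by
  simp only [twistedForm, map_zero, mul_zero, radialTwist_zero]
  rw [star_mulVec_dotProduct_mulVec hM, star_dotProduct_self, hb, Complex.ofReal_one]

lemma hasDerivAt_twistedForm_mulVec_zero (b : n → ℂ) :
    HasDerivAt (twistedForm M s t (M *ᵥ b) b)
      (-(s / 2 * vecEntropy (M *ᵥ b) + t / 2 * vecEntropy b) : ℝ) 0 := by
  rw [twistedForm_eq]
  refine (hasDerivAt_dotProduct_mulVec (hasDerivAt_radialTwist s (star (M *ᵥ b)) 0)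
    (hasDerivAt_radialTwist t b 0)).congr_deriv ?_
  simp only [mul_zero, radialTwist_zero]
  have hx := star_dotProduct_mul_log_norm s (star (M *ᵥ b))
  rw [star_star, dotProduct_comm, vecEntropy_star] at hx
  rw [hx, star_mulVec_dotProduct_mulVec hM, star_dotProduct_mul_log_norm]
  push_cast
  ring

lemma norm_twistedForm_le_one {s t : ℝ} (hs : 0 ≤ s) (ht : 0 ≤ t) {a : m → ℂ}
    (ha : ∑ i, ‖a i‖ ^ 2 ≤ 1) (hb : ∑ j, ‖b j‖ ^ 2 ≤ 1) {z : ℂ} (hz : 0 ≤ z.re) :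
    ‖twistedForm M s t a b z‖ ≤ 1 := by
  refine (sq_le_one_iff₀ (norm_nonneg _)).mp ((norm_dotProduct_mulVec_sq_le hM _ _).trans ?_)
  refine mul_le_one₀ ?_ (Finset.sum_nonneg fun _ _ => sq_nonneg _)
    (sum_sq_norm_radialTwist_le_one (by simpa using mul_nonneg ht hz) hb)
  simp only [Pi.star_apply, norm_star]
  exact sum_sq_norm_radialTwist_le_one (by simpa using mul_nonneg hs hz) ha

end

section

variable {d : ℕ} {M : Matrix (Fin d) (Fin d) ℂ} {N lam mu : ℝ} (hN : 0 < N) (hlam : 0 ≤ lam)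
  (hmu : 0 ≤ mu)
include hN hlam hmu

lemma norm_star_dotProduct_mulVec_le_omega {x y : Fin d → ℂ} (hx : x ∈ pBall d (ballExp N lam))
    (hy : y ∈ pBall d (ballExp N mu)) : ‖star x ⬝ᵥ M *ᵥ y‖ ≤ omega M N lam mu :=
  le_csSup (bddAbove_omegaSet M hN hlam hmu) ⟨x, hx, y, hy, rfl⟩

lemma norm_apply_le_omega (i j : Fin d) : ‖M i j‖ ≤ omega M N lam mu := by
  have hball {c : ℝ} (hc : 0 ≤ c) (i : Fin d) : Pi.single i 1 ∈ pBall d (ballExp N c) := by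
    have hp : 2 * N / (N + 2 * c) ≠ 0 := by positivity
    rw [mem_pBall_ballExp_iff hN hc]
    simp [Pi.single_apply, apply_ite (fun z : ℂ => ‖z‖ ^ (2 * N / (N + 2 * c))),
      Real.zero_rpow hp]
  simpa using norm_star_dotProduct_mulVec_le_omega (M := M) hN hlam hmu (hball hlam i)
    (hball hmu j)

lemma omega_pos (hM : M ≠ 0) : 0 < omega M N lam mu := by
  contrapose! hM
  ext i j
  exact norm_le_zero_iff.mp ((norm_apply_le_omega hN hlam hmu i j).trans hM)

variable (hM : Mᴴ * M = 1)
include hM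

lemma norm_twistedForm_le_omega_rpow {a b : Fin d → ℂ} (ha : ∑ i, ‖a i‖ ^ 2 ≤ 1)
    (hb : ∑ i, ‖b i‖ ^ 2 ≤ 1) {σ : ℝ} (hσ : σ ∈ Set.Icc (0 : ℝ) 1) :
    ‖twistedForm M (2 * lam / N) (2 * mu / N) a b σ‖ ≤ omega M N lam mu ^ σ := by
  have hone {z : ℂ} : 0 ≤ z.re → ‖twistedForm M (2 * lam / N) (2 * mu / N) a b z‖ ≤ 1 :=
    norm_twistedForm_le_one hM (by positivity) (by positivity) ha hb
  have hω {z : ℂ} (hz : z.re = 1) :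
      ‖twistedForm M (2 * lam / N) (2 * mu / N) a b z‖ ≤ omega M N lam mu :=
    norm_star_dotProduct_mulVec_le_omega hN hlam hmu
      (radialTwist_mem_pBall hN hlam (by simp [hz]) ha)
      (radialTwist_mem_pBall hN hmu (by simp [hz]) hb)
  have h := Complex.HadamardThreeLines.norm_le_interp_of_mem_verticalClosedStrip₀₁'
    (twistedForm M (2 * lam / N) (2 * mu / N) a b) (z := σ)
    (by simpa [Complex.HadamardThreeLines.verticalClosedStrip] using hσ)
    (differentiable_twistedForm _ _ M a b).diffContOnCl
    ⟨1, by rintro _ ⟨z, hz, rfl⟩; exact hone hz.1⟩ (fun z hz => hone hz.ge) (fun z => hω)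
  simpa using h

end

lemma hasDerivAt_le_of_eventually_le_nhdsGT {f g : ℝ → ℝ} {f' g' x : ℝ}
    (hf : HasDerivAt f f' x) (hg : HasDerivAt g g' x) (hx : f x = g x)
    (h : ∀ᶠ y in 𝓝[>] x, f y ≤ g y) : f' ≤ g' := by
  refine le_of_tendsto_of_tendsto (hf.tendsto_slope.mono_left (nhdsGT_le_nhdsNE x))
    (hg.tendsto_slope.mono_left (nhdsGT_le_nhdsNE x)) ?_
  filter_upwards [h, self_mem_nhdsWithin] with y hy hxy
  rw [slope_def_field, slope_def_field, hx]
  gcongr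
  exact sub_nonneg.mpr (le_of_lt hxy)

theorem neg_mul_log_omega_le_vecEntropy {d : ℕ} [NeZero d] {M : Matrix (Fin d) (Fin d) ℂ}
    (hM : Mᴴ * M = 1) {N lam mu : ℝ} (hN : 0 < N) (hlam : 0 ≤ lam) (hmu : 0 ≤ mu) {b : Fin d → ℂ}
    (hb : ∑ i, ‖b i‖ ^ 2 = 1) :
    -N * Real.log (omega M N lam mu) ≤ lam * vecEntropy (M *ᵥ b) + mu * vecEntropy b := by
  have hω : 0 < omega M N lam mu := omega_pos hN hlam hmu (by rintro rfl; simp at hM)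
  have hpow : HasDerivAt (fun σ : ℝ => omega M N lam mu ^ σ) (Real.log (omega M N lam mu)) 0 := by
    simpa using (Real.hasStrictDerivAt_const_rpow hω 0).hasDerivAt
  have hform := (hasDerivAt_twistedForm_mulVec_zero (2 * lam / N) (2 * mu / N) hM
    b).real_of_complex (z := 0)
  have ha := (sum_sq_norm_mulVec hM b).trans hb
  have h := hasDerivAt_le_of_eventually_le_nhdsGT hform hpow
    (by simp [twistedForm_mulVec_zero _ _ hM hb]) <| by
      filter_upwards [Ioo_mem_nhdsGT one_pos] with σ hσ
      exact (Complex.re_le_norm _).trans (norm_twistedForm_le_omega_rpow hN hlam hmu hM ha.le hb.le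
        (Set.Ioo_subset_Icc_self hσ))
  rw [Complex.ofReal_re] at h
  calc -N * Real.log (omega M N lam mu)
      ≤ -N * -(2 * lam / N / 2 * vecEntropy (M *ᵥ b) + 2 * mu / N / 2 * vecEntropy b) :=
        mul_le_mul_of_nonpos_left h (by linarith)
    _ = _ := by field_simp

end MaassenUffink

section Limit

variable {ι : Type*} [Fintype ι]

lemma add_mul_negMulLog_le_rpow {q : ℝ} (hq : 0 ≤ q) (s : ℝ) :
    q + (1 - s) * Real.negMulLog q ≤ q ^ s := by
  rcases hq.eq_or_lt with rfl | hq
  · simpa using Real.rpow_nonneg le_rfl s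
  calc q + (1 - s) * Real.negMulLog q = q * ((s - 1) * Real.log q + 1) := by
        rw [Real.negMulLog]
        ring
    _ ≤ q * Real.exp ((s - 1) * Real.log q) := by
        gcongr
        exact Real.add_one_le_exp _
    _ = q ^ s := by
        rw [mul_comm (s - 1), ← Real.rpow_def_of_pos hq, Real.rpow_sub_one hq.ne',
          mul_div_cancel₀ _ hq.ne']

lemma sum_sq_add_mul_vecEntropy_le_sum_rpow (x : ι → ℂ) (s : ℝ) :
    ∑ i, ‖x i‖ ^ 2 + (1 - s) * vecEntropy x ≤ ∑ i, ‖x i‖ ^ (2 * s) := by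
  rw [vecEntropy, Finset.mul_sum, ← Finset.sum_add_distrib]
  refine Finset.sum_le_sum fun i _ => ?_
  rw [Real.rpow_mul (norm_nonneg _), Real.rpow_two]
  exact add_mul_negMulLog_le_rpow (sq_nonneg _) s

section

variable {d : ℕ} {N lam : ℝ} (hN : 0 < N) (hlam : 0 ≤ lam) {x : Fin d → ℂ}
  (hx : x ∈ pBall d (ballExp N lam))
include hN hlam hx

lemma sum_sq_add_mul_vecEntropy_le_one :
    ∑ i, ‖x i‖ ^ 2 + 2 * lam / (N + 2 * lam) * vecEntropy x ≤ 1 := by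
  have h := sum_sq_add_mul_vecEntropy_le_sum_rpow x (N / (N + 2 * lam))
  have hs : 1 - N / (N + 2 * lam) = 2 * lam / (N + 2 * lam) := by
    field_simp
    ring
  rw [hs, ← mul_div_assoc] at h
  exact h.trans ((mem_pBall_ballExp_iff hN hlam).mp hx)

lemma sum_sq_le_one_of_mem_pBall : ∑ i, ‖x i‖ ^ 2 ≤ 1 := by
  have hp : 0 < (ballExp N lam).toReal := by
    rw [ballExp, ENNReal.toReal_ofReal] <;> positivity
  have hH : 0 ≤ 2 * lam / (N + 2 * lam) * vecEntropy x :=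
    mul_nonneg (by positivity) (vecEntropy_nonneg (norm_le_one_of_mem_pBall hp hx))
  linarith [sum_sq_add_mul_vecEntropy_le_one hN hlam hx]

lemma sum_sq_le_exp_neg_vecEntropy :
    ∑ i, ‖x i‖ ^ 2 ≤ Real.exp (-(lam / (N + 2 * lam) * vecEntropy x)) ^ 2 := by
  calc ∑ i, ‖x i‖ ^ 2 ≤ 1 - 2 * lam / (N + 2 * lam) * vecEntropy x :=
        le_sub_iff_add_le.mpr (sum_sq_add_mul_vecEntropy_le_one hN hlam hx)
    _ ≤ Real.exp (-(2 * lam / (N + 2 * lam) * vecEntropy x)) := Real.one_sub_le_exp_neg _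
    _ = Real.exp (-(lam / (N + 2 * lam) * vecEntropy x)) ^ 2 := by
        rw [← Real.exp_nat_mul]
        congr 1
        push_cast
        ring

end

lemma norm_star_dotProduct_mulVec_le_exp {d : ℕ} {M : Matrix (Fin d) (Fin d) ℂ} (hM : Mᴴ * M = 1)
    {N lam mu : ℝ} (hN : 0 < N) (hlam : 0 ≤ lam) (hmu : 0 ≤ mu) {x y : Fin d → ℂ}
    (hx : x ∈ pBall d (ballExp N lam)) (hy : y ∈ pBall d (ballExp N mu)) :
    ‖star x ⬝ᵥ M *ᵥ y‖ ≤
      Real.exp (-(lam / (N + 2 * lam) * vecEntropy x + mu / (N + 2 * mu) * vecEntropy y)) := by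
  rw [neg_add, Real.exp_add, ← sq_le_sq₀ (norm_nonneg _) (by positivity), mul_pow]
  refine (norm_dotProduct_mulVec_sq_le hM _ _).trans ?_
  simp only [Pi.star_apply, norm_star]
  gcongr
  · exact sum_sq_le_exp_neg_vecEntropy hN hlam hx
  · exact sum_sq_le_exp_neg_vecEntropy hN hmu hy

lemma exists_eq_smul_of_one_le_norm_inner {𝕜 E : Type*} [RCLike 𝕜] [NormedAddCommGroup E]
    [InnerProductSpace 𝕜 E] {x y : E} (hx : ‖x‖ ≤ 1) (hy : ‖y‖ ≤ 1) (h : 1 ≤ ‖inner 𝕜 y x‖) :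
    ‖y‖ = 1 ∧ ∃ z : 𝕜, ‖z‖ = 1 ∧ x = z • y := by
  have hyx : 1 ≤ ‖y‖ * ‖x‖ := h.trans (norm_inner_le_norm y x)
  have hx1 : ‖x‖ = 1 := hx.antisymm (hyx.trans (mul_le_of_le_one_left (norm_nonneg _) hy))
  have hy1 : ‖y‖ = 1 := hy.antisymm (hyx.trans (mul_le_of_le_one_right (norm_nonneg _) hx))
  have hx0 : x ≠ 0 := norm_ne_zero_iff.mp (by simp [hx1])
  have hy0 : y ≠ 0 := norm_ne_zero_iff.mp (by simp [hy1])
  have heq : ‖inner 𝕜 y x‖ = ‖y‖ * ‖x‖ :=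
    (norm_inner_le_norm y x).antisymm (by rwa [hx1, hy1, mul_one])
  obtain ⟨z, -, rfl⟩ := (norm_inner_eq_norm_iff hy0 hx0).mp heq
  refine ⟨hy1, z, ?_, rfl⟩
  rwa [norm_smul, hy1, mul_one] at hx1

lemma exists_eq_smul_of_one_le_norm_star_dotProduct {x y : ι → ℂ} (hx : ∑ i, ‖x i‖ ^ 2 ≤ 1)
    (hy : ∑ i, ‖y i‖ ^ 2 ≤ 1) (h : 1 ≤ ‖star x ⬝ᵥ y‖) :
    ∑ i, ‖y i‖ ^ 2 = 1 ∧ ∃ z : ℂ, ‖z‖ = 1 ∧ x = z • y := by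
  have hnorm (a : ι → ℂ) : ‖(WithLp.toLp 2 a : EuclideanSpace ℂ ι)‖ ^ 2 = ∑ i, ‖a i‖ ^ 2 :=
    EuclideanSpace.norm_sq_eq _
  rw [← hnorm, sq_le_one_iff₀ (norm_nonneg _)] at hx hy
  rw [Matrix.star_dotProduct, norm_star, dotProduct_comm, ← EuclideanSpace.inner_toLp_toLp] at h
  obtain ⟨hy1, z, hz, hxy⟩ := exists_eq_smul_of_one_le_norm_inner hx hy h
  exact ⟨by rw [← hnorm, hy1, one_pow], z, hz, WithLp.toLp_injective 2 hxy⟩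

lemma isCompact_setOf_sum_sq_norm_le_one : IsCompact {x : ι → ℂ | ∑ i, ‖x i‖ ^ 2 ≤ 1} := by
  refine (isCompact_closedBall (0 : ι → ℂ) 1).of_isClosed_subset
    (isClosed_le (by fun_prop) continuous_const) fun x hx => ?_
  rw [mem_closedBall_zero_iff, pi_norm_le_iff_of_nonneg zero_le_one]
  exact norm_le_one_of_sum_sq_le_one hx

lemma tendsto_mul_div_add_atTop (c : ℝ) :
    Tendsto (fun N : ℝ => N * (c / (N + 2 * c))) atTop (𝓝 c) := by
  have h : Tendsto (fun N : ℝ => c / (1 + 2 * c / N)) atTop (𝓝 (c / (1 + 0))) :=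
    tendsto_const_nhds.div (tendsto_const_nhds.add (tendsto_const_nhds.div_atTop tendsto_id))
      (by norm_num)
  rw [add_zero, div_one] at h
  refine h.congr' ?_
  filter_upwards [eventually_gt_atTop 0] with N hN
  rw [one_add_div hN.ne', div_div_eq_mul_div, mul_comm, mul_div_assoc]

lemma tendsto_exp_neg_div_atTop (K : ℝ) :
    Tendsto (fun N : ℝ => Real.exp (-(K / N))) atTop (𝓝 1) := by
  have h : Tendsto (fun N : ℝ => -(K / N)) atTop (𝓝 (-0)) :=
    (tendsto_const_nhds.div_atTop tendsto_id).neg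
  simpa using h.rexp

section

variable {d : ℕ} {M : Matrix (Fin d) (Fin d) ℂ} (hM : Mᴴ * M = 1) {lam mu K : ℝ}
  (hlam : 0 ≤ lam) (hmu : 0 ≤ mu)
include hM hlam hmu

lemma eventually_norm_star_dotProduct_mulVec_le_exp_of_lt {x₀ y₀ : Fin d → ℂ}
    (hK : K < lam * vecEntropy x₀ + mu * vecEntropy y₀) :
    ∀ᶠ q : ℝ × (Fin d → ℂ) × (Fin d → ℂ) in atTop ×ˢ 𝓝 (x₀, y₀),
      q.2.1 ∈ pBall d (ballExp q.1 lam) → q.2.2 ∈ pBall d (ballExp q.1 mu) →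
        ‖star q.2.1 ⬝ᵥ M *ᵥ q.2.2‖ ≤ Real.exp (-(K / q.1)) := by
  have hx : Tendsto (fun q : ℝ × (Fin d → ℂ) × (Fin d → ℂ) => vecEntropy q.2.1)
      (atTop ×ˢ 𝓝 (x₀, y₀)) (𝓝 (vecEntropy x₀)) :=
    ((continuous_vecEntropy.comp continuous_fst).tendsto (x₀, y₀)).comp tendsto_snd
  have hy : Tendsto (fun q : ℝ × (Fin d → ℂ) × (Fin d → ℂ) => vecEntropy q.2.2)
      (atTop ×ˢ 𝓝 (x₀, y₀)) (𝓝 (vecEntropy y₀)) :=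
    ((continuous_vecEntropy.comp continuous_snd).tendsto (x₀, y₀)).comp tendsto_snd
  have hlim := (((tendsto_mul_div_add_atTop lam).comp tendsto_fst).mul hx).add
    (((tendsto_mul_div_add_atTop mu).comp tendsto_fst).mul hy)
  filter_upwards [hlim.eventually_const_lt hK, tendsto_fst.eventually (eventually_gt_atTop 0)]
    with q hq hN hqx hqy
  refine (norm_star_dotProduct_mulVec_le_exp hM hN hlam hmu hqx hqy).trans ?_
  gcongr
  rw [div_le_iff₀' hN, mul_add, ← mul_assoc, ← mul_assoc]
  exact hq.le

variable (hK : ∀ b : Fin d → ℂ, ∑ j, ‖b j‖ ^ 2 = 1 →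
  K < lam * vecEntropy (M *ᵥ b) + mu * vecEntropy b)
include hK

lemma eventually_norm_star_dotProduct_mulVec_le_exp_nhds {x₀ y₀ : Fin d → ℂ}
    (hx₀ : ∑ i, ‖x₀ i‖ ^ 2 ≤ 1) (hy₀ : ∑ i, ‖y₀ i‖ ^ 2 ≤ 1) :
    ∀ᶠ q : ℝ × (Fin d → ℂ) × (Fin d → ℂ) in atTop ×ˢ 𝓝 (x₀, y₀),
      q.2.1 ∈ pBall d (ballExp q.1 lam) → q.2.2 ∈ pBall d (ballExp q.1 mu) →
        ‖star q.2.1 ⬝ᵥ M *ᵥ q.2.2‖ ≤ Real.exp (-(K / q.1)) := by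
  rcases lt_or_ge ‖star x₀ ⬝ᵥ M *ᵥ y₀‖ 1 with h | h
  · have hform : Continuous fun q : (Fin d → ℂ) × (Fin d → ℂ) => ‖star q.1 ⬝ᵥ M *ᵥ q.2‖ := by
      fun_prop
    have hlt := ((hform.tendsto (x₀, y₀)).comp tendsto_snd).eventually_lt
      ((tendsto_exp_neg_div_atTop K).comp tendsto_fst) h
    filter_upwards [hlt] with q hq _ _ using hq.le
  · obtain ⟨hMy, z, hz, rfl⟩ := exists_eq_smul_of_one_le_norm_star_dotProduct hx₀
      ((sum_sq_norm_mulVec hM y₀).trans_le hy₀) h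
    refine eventually_norm_star_dotProduct_mulVec_le_exp_of_lt hM hlam hmu ?_
    rw [vecEntropy_smul hz]
    exact hK y₀ ((sum_sq_norm_mulVec hM y₀).symm.trans hMy)

lemma eventually_omega_le_exp :
    ∀ᶠ N in atTop, omega M N lam mu ≤ Real.exp (-(K / N)) := by
  have hball := isCompact_setOf_sum_sq_norm_le_one (ι := Fin d)
  have h := (hball.prod hball).mem_prod_nhdsSet_of_forall fun q hq =>
    eventually_norm_star_dotProduct_mulVec_le_exp_nhds hM hlam hmu hK hq.1 hq.2
  filter_upwards [Eventually.curry h, eventually_gt_atTop 0] with N hform hN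
  refine Real.sSup_le ?_ (Real.exp_pos _).le
  rintro _ ⟨x, hx, y, hy, rfl⟩
  exact (Eventually.self_of_nhdsSet hform) (x, y) ⟨sum_sq_le_one_of_mem_pBall hN hlam hx,
    sum_sq_le_one_of_mem_pBall hN hmu hy⟩ hx hy

end

end Limit

section OptConst

variable {d : ℕ} [NeZero d]

lemma omega_eq_opNorm (M : Matrix (Fin d) (Fin d) ℂ) {N lam mu : ℝ} (hN : 0 < N) (hlam : 0 ≤ lam)
    (hmu : 0 ≤ mu) (hlamN : lam ≤ N / 2) (hmuN : mu ≤ N / 2) :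
    omega M N lam mu = opNorm M (ballExp N mu) (dualExp N lam) := by
  have := holderConjugate_ballExp_dualExp hN hlam hlamN
  have := holderConjugate_ballExp_dualExp hN hmu hmuN
  exact sSup_omegaSet_eq_opNorm M (ENNReal.HolderConjugate.one_le _ (dualExp N mu))

variable {H : Type*} [NormedAddCommGroup H] [InnerProductSpace ℂ H]
  (e : OrthonormalBasis (Fin d) ℂ H) (U : H ≃ₗᵢ[ℂ] H) {lam mu : ℝ}

theorem neg_mul_log_omega_le_optConst {N : ℝ} (hN : 0 < N) (hlam : 0 ≤ lam) (hmu : 0 ≤ mu) :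
    -N * Real.log (omega (basisMatrix e U) N lam mu) ≤ optConst e U lam mu :=
  (le_optConst_iff e U hlam hmu).mpr fun _ hb =>
    neg_mul_log_omega_le_vecEntropy (conjTranspose_mul_basisMatrix e U) hN hlam hmu hb

lemma eventually_le_neg_mul_log_omega (hlam : 0 ≤ lam) (hmu : 0 ≤ mu) {K : ℝ}
    (hK : K < optConst e U lam mu) :
    ∀ᶠ N in atTop, K ≤ -N * Real.log (omega (basisMatrix e U) N lam mu) := by
  have hM := conjTranspose_mul_basisMatrix e U
  have hω := eventually_omega_le_exp hM hlam hmu fun b hb =>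
    hK.trans_le ((le_optConst_iff e U hlam hmu).mp le_rfl b hb)
  filter_upwards [hω, eventually_gt_atTop 0] with N hω hN
  have hlog : Real.log (omega (basisMatrix e U) N lam mu) ≤ -(K / N) :=
    (Real.log_le_iff_le_exp (omega_pos hN hlam hmu (right_ne_zero_of_mul_eq_one hM))).mpr hω
  calc K = -N * -(K / N) := by field_simp
    _ ≤ _ := mul_le_mul_of_nonpos_left hlog (by linarith)

theorem tendsto_neg_mul_log_omega (hlam : 0 ≤ lam) (hmu : 0 ≤ mu) :
    Tendsto (fun N : ℝ => -N * Real.log (omega (basisMatrix e U) N lam mu)) atTop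
      (𝓝 (optConst e U lam mu)) := by
  refine tendsto_order.mpr ⟨fun K hK => ?_, fun K hK => ?_⟩
  · obtain ⟨K', hKK', hK'⟩ := exists_between hK
    exact (eventually_le_neg_mul_log_omega e U hlam hmu hK').mono fun N hN => hKK'.trans_le hN
  · filter_upwards [eventually_gt_atTop 0] with N hN
    exact (neg_mul_log_omega_le_optConst e U hN hlam hmu).trans_lt hK

end OptConst

end EntropicUncertainty

theorem theorem1_general {d : ℕ} (hd : 1 ≤ d)
    {H : Type*} [NormedAddCommGroup H] [InnerProductSpace ℂ H]
    (e : OrthonormalBasis (Fin d) ℂ H) (U : H ≃ₗᵢ[ℂ] H)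
    (lam mu : ℝ) (hlam : 0 ≤ lam) (hmu : 0 ≤ mu) :
    (∀ N : ℝ, 0 < N →
      -N * Real.log (omega (basisMatrix e U) N lam mu) ≤ optConst e U lam mu) ∧
    (∀ N : ℝ, 0 < N → lam ≤ N / 2 → mu ≤ N / 2 →
      omega (basisMatrix e U) N lam mu
          = opNorm (basisMatrix e U) (ballExp N mu) (dualExp N lam) ∧
      omega (basisMatrix e U) N lam mu
          = opNorm (basisMatrix e U).conjTranspose (ballExp N lam) (dualExp N mu)) ∧
    Filter.Tendsto (fun N : ℝ => -N * Real.log (omega (basisMatrix e U) N lam mu))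
      Filter.atTop (nhds (optConst e U lam mu)) := by
  have : NeZero d := ⟨Nat.one_le_iff_ne_zero.mp hd⟩
  refine ⟨fun N hN => neg_mul_log_omega_le_optConst e U hN hlam hmu,
    fun N hN hlamN hmuN => ⟨omega_eq_opNorm _ hN hlam hmu hlamN hmuN, ?_⟩,
    tendsto_neg_mul_log_omega e U hlam hmu⟩
  rw [← omega_conjTranspose]
  exact omega_eq_opNorm _ hN hmu hlam hmuN hlamN

theorem theorem1 {d : ℕ} (hd : 1 ≤ d)
    {H : Type*} [NormedAddCommGroup H] [InnerProductSpace ℂ H]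
    (e : OrthonormalBasis (Fin d) ℂ H) (U : H ≃ₗᵢ[ℂ] H)
    (lam mu : ℝ) (hlam : 0 ≤ lam) (hmu : 0 ≤ mu) :
    (∀ N : ℝ, 1 ≤ N →
      -N * Real.log (omega (basisMatrix e U) N lam mu) ≤ optConst e U lam mu) ∧
    (∀ N : ℝ, 1 ≤ N → lam ≤ N / 2 → mu ≤ N / 2 →
      omega (basisMatrix e U) N lam mu
          = opNorm (basisMatrix e U) (ballExp N mu) (dualExp N lam) ∧
      omega (basisMatrix e U) N lam mu
          = opNorm (basisMatrix e U).conjTranspose (ballExp N lam) (dualExp N mu)) ∧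
    (0 < lam → 0 < mu →
      Filter.Tendsto (fun N : ℝ => -N * Real.log (omega (basisMatrix e U) N lam mu))
        Filter.atTop (nhds (optConst e U lam mu))) := by
  obtain ⟨hbound, hnorm, hlim⟩ := theorem1_general hd e U lam mu hlam hmu
  exact ⟨fun N hN => hbound N (by linarith), fun N hN => hnorm N (by linarith), fun _ _ => hlim⟩
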